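/- For a finite simple graph $G$, let $\alpha(G)$ be its stability number (the maximum size of a stable set, i.e. a set of pairwise non-adjacent vertices) and let $F(G)$ be its Fibonacci index (the number of stable sets of $G$, including the empty set). For an integer $n \ge 5$ let $$\mathcal P_G(n) = \operatorname{conv}\{(\alpha(G), F(G)) : G \text{ a graph of order } n\} \subset \mathbb R^2 .$$ Consider the $n$ linear inequalities $$y \ge (2^k-1)x + 2^k(1-k) + n \quad (k = 1, 2, \dots, n-1), \qquad y \le \frac{2^n-n-1}{n-1}(x-1) + n+1 .$$ Then these inequalities form a complete and minimal description of $\mathcal P_G(n)$: a point $(x,y) \in \mathbb R^2$ belongs to $\mathcal P_G(n)$ if and only if it satisfies all of them, and this fails if any one of them is dropped. Moreover, $\mathcal P_G(n)$ has exactly $n$ facets, and they are precisely the sets of points of $\mathcal P_G(n)$ at which one of these $n$ inequalities holds with equality. (A facet of a polytope $P$ is a nonempty set of the form $\{p \in P : \ell(p) = c\}$, where $\ell$ is linear and $\ell \le c$ on $P$, whose dimension is $\dim P - 1$.) -/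

import Mathlib

/-- The Fibonacci index `F(G)`: the number of stable (independent) sets of `G`,
the empty set included. -/
noncomputable def fibonacciIndex {V : Type*} (G : SimpleGraph V) : ℕ :=
  {s : Finset V | G.IsIndepSet (s : Set V)}.ncard

/-- The convex hull in the plane of the points `(α(G), F(G))`, for `G` a graph of order `n`
(every such graph is isomorphic to a graph on `Fin n`, and both invariants are invariant under
isomorphism). -/
noncomputable def polyG (n : ℕ) : Set (ℝ × ℝ) :=
  convexHull ℝ {p : ℝ × ℝ | ∃ G : SimpleGraph (Fin n),
    (G.indepNum : ℝ) = p.1 ∧ (fibonacciIndex G : ℝ) = p.2}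

/-- `F` is a facet of `P`: it is cut out of `P` by equality in a linear inequality `l x ≤ c` that is
valid on `P`, it is nonempty, and its affine dimension is one less than that of `P`. -/
def IsFacet {E : Type*} [AddCommGroup E] [Module ℝ E] (P F : Set E) : Prop :=
  (∃ (l : E →ₗ[ℝ] ℝ) (c : ℝ), (∀ x ∈ P, l x ≤ c) ∧ F = {x ∈ P | l x = c}) ∧
  F.Nonempty ∧
  Module.finrank ℝ (vectorSpan ℝ F) + 1 = Module.finrank ℝ (vectorSpan ℝ P)

/-- The right-hand side `(2 ^ k - 1) x + 2 ^ k (1 - k) + n` of the `k`-th lower inequality. -/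
def lowerLine (n k : ℕ) (x : ℝ) : ℝ :=
  ((2 : ℝ) ^ k - 1) * x + (2 : ℝ) ^ k * (1 - (k : ℝ)) + (n : ℝ)

/-- The right-hand side `(2 ^ n - n - 1) / (n - 1) * (x - 1) + n + 1` of the upper inequality. -/
noncomputable def upperLine (n : ℕ) (x : ℝ) : ℝ :=
  ((2 : ℝ) ^ n - (n : ℝ) - 1) / ((n : ℝ) - 1) * (x - 1) + (n : ℝ) + 1

/-!
Among the graphs with a prescribed stable set `s`, the one with the most edges, hence the fewest
stable sets, is the complete split graph; it has `2 ^ a - a + n` stable sets for `a = #s`. The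
points `(a, 2 ^ a - a + n)`, `1 ≤ a ≤ n`, lie on a convex curve, and the lower inequalities are the
chords joining consecutive ones. The upper inequality is the chord joining the extreme ones:
Turán's theorem for the complement puts the graphs with `α ≤ 2` below it, and for `3 ≤ α ≤ n` the
bound `F ≤ (4 / 3) ^ α * (3 / 2) ^ n`, convex in `α`, need only be compared with it at `α = 3` and
`α = n`.

Minimality and the list of facets follow from one property of the system: each inequality can be
tight while all the others are strict.
-/

section Polyhedron

variable {E : Type*} [AddCommGroup E] [Module ℝ E]

theorem affineMap_smul_add_apply (g : E →ᵃ[ℝ] ℝ) (ε : ℝ) (v x : E) :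
    g (ε • v + x) = ε * g.linear v + g x := by
  simpa using g.map_vadd x (ε • v)

theorem vectorSpan_le_ker_linear {g : E →ᵃ[ℝ] ℝ} {s : Set E} {c : ℝ} (h : ∀ x ∈ s, g x = c) :
    vectorSpan ℝ s ≤ LinearMap.ker g.linear := by
  refine Submodule.span_le.2 ?_
  rintro _ ⟨x, hx, y, hy, rfl⟩
  rw [SetLike.mem_coe, LinearMap.mem_ker, g.linearMap_vsub, h x hx, h y hy, vsub_self]

variable {ι : Type*} {g : ι → E →ᵃ[ℝ] ℝ} {x : E}

/-- The polyhedron described by the affine inequalities `0 ≤ g i x`. -/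
def polyhedron (g : ι → E →ᵃ[ℝ] ℝ) : Set E :=
  {x | ∀ i, 0 ≤ g i x}

/-- The face of `polyhedron g` on which the inequality of index `i` is tight. -/
def polyhedronFace (g : ι → E →ᵃ[ℝ] ℝ) (i : ι) : Set E :=
  {x ∈ polyhedron g | g i x = 0}

/-- Irredundancy of the system `0 ≤ g i x`: each inequality can be tight while all the others are
strict, so that every `polyhedronFace g i` has a point lying on no other face. -/
def IsIrredundant (g : ι → E →ᵃ[ℝ] ℝ) : Prop :=
  ∀ i, ∃ p, g i p = 0 ∧ ∀ j ≠ i, 0 < g j p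

theorem convex_polyhedron (g : ι → E →ᵃ[ℝ] ℝ) : Convex ℝ (polyhedron g) := by
  rw [polyhedron, Set.ofPred_forall]
  exact convex_iInter fun i => (convex_Ici 0).affine_preimage (g i)

theorem mem_polyhedronFace_of_forall_ne {i : ι} (hi : g i x = 0) (hne : ∀ j ≠ i, 0 ≤ g j x) :
    x ∈ polyhedronFace g i := by
  refine ⟨fun j => ?_, hi⟩
  by_cases hj : j = i
  · exact hj ▸ hi.ge
  · exact hne j hj

theorem exists_pos_forall_nonneg [Finite ι] (hx : ∀ i, 0 < g i x) (v : E) :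
    ∃ ε : ℝ, 0 < ε ∧ ∀ i, 0 ≤ g i (ε • v + x) := by
  have near_zero : ∀ i, ∀ᶠ ε : ℝ in nhdsWithin 0 (Set.Ioi 0), 0 ≤ g i (ε • v + x) := fun i => by
    have hcont : Continuous fun ε : ℝ => ε * (g i).linear v + g i x := by fun_prop
    filter_upwards [mem_nhdsWithin_of_mem_nhds
      ((hcont.tendsto 0).eventually (lt_mem_nhds (by simpa using hx i)))] with ε hε
    rw [affineMap_smul_add_apply]
    exact hε.le
  obtain ⟨ε, hε, hpos⟩ := ((Filter.eventually_all.2 near_zero).and self_mem_nhdsWithin).exists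
  exact ⟨ε, hpos, hε⟩

theorem exists_mem_forall_pos [Finite ι] {s : Set E} (hs : Convex ℝ s) (hne : s.Nonempty)
    (hnonneg : s ⊆ polyhedron g) (hpos : ∀ i, ∃ x ∈ s, 0 < g i x) :
    ∃ x ∈ s, ∀ i, 0 < g i x := by
  classical
  cases nonempty_fintype ι
  suffices ∀ t : Finset ι, ∃ x ∈ s, ∀ i ∈ t, 0 < g i x by simpa using this Finset.univ
  intro t
  induction t using Finset.induction with
  | empty =>
    obtain ⟨x, hx⟩ := hne
    exact ⟨x, hx, by simp⟩
  | insert i t _ ih =>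
    obtain ⟨x, hx, hxt⟩ := ih
    obtain ⟨y, hy, hyi⟩ := hpos i
    have apply_midpoint : ∀ j, g j (midpoint ℝ x y) = (g j x + g j y) / 2 := fun j => by
      rw [AffineMap.map_midpoint, midpoint_eq_smul_add, smul_eq_mul, invOf_eq_inv]
      ring
    refine ⟨midpoint ℝ x y, hs.midpoint_mem hx hy, fun j hj => ?_⟩
    rw [apply_midpoint]
    rcases Finset.mem_insert.1 hj with rfl | hj
    · linarith [hnonneg hx j]
    · linarith [hxt j hj, hnonneg hy j]

theorem vectorSpan_polyhedron_eq_top [Finite ι] (hx : ∀ i, 0 < g i x) :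
    vectorSpan ℝ (polyhedron g) = ⊤ := by
  refine eq_top_iff.2 fun v _ => ?_
  obtain ⟨ε, hε, hmem⟩ := exists_pos_forall_nonneg hx v
  have hspan := vsub_mem_vectorSpan ℝ (show ε • v + x ∈ polyhedron g from hmem)
    (show x ∈ polyhedron g from fun i => (hx i).le)
  rwa [vsub_eq_sub, add_sub_cancel_right, Submodule.smul_mem_iff _ hε.ne'] at hspan

theorem vectorSpan_polyhedronFace [Finite ι] {i : ι} (hi : g i x = 0)
    (hne : ∀ j ≠ i, 0 < g j x) :
    vectorSpan ℝ (polyhedronFace g i) = LinearMap.ker (g i).linear := by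
  refine (vectorSpan_le_ker_linear fun y hy => hy.2).antisymm fun v hv => ?_
  obtain ⟨ε, hε, hmem⟩ := exists_pos_forall_nonneg (g := fun j : {j // j ≠ i} => g j)
    (fun j => hne j j.2) v
  have hface : ε • v + x ∈ polyhedronFace g i :=
    mem_polyhedronFace_of_forall_ne
      (by rw [affineMap_smul_add_apply, LinearMap.mem_ker.1 hv, hi, mul_zero, add_zero])
      fun j hj => hmem ⟨j, hj⟩
  have hspan := vsub_mem_vectorSpan ℝ hface
    (mem_polyhedronFace_of_forall_ne hi fun j hj => (hne j hj).le)
  rwa [vsub_eq_sub, add_sub_cancel_right, Submodule.smul_mem_iff _ hε.ne'] at hspan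

theorem linear_ne_zero_of_apply_ne {g : E →ᵃ[ℝ] ℝ} {x y : E} (h : g x ≠ g y) :
    g.linear ≠ 0 := fun h0 => by
  have := g.linearMap_vsub x y
  rw [h0, LinearMap.zero_apply, vsub_eq_sub] at this
  exact h (sub_eq_zero.1 this.symm)

theorem isFacet_polyhedronFace [Finite ι] [FiniteDimensional ℝ E] {p : E} {i : ι}
    (hx : ∀ j, 0 < g j x) (hi : g i p = 0) (hne : ∀ j ≠ i, 0 < g j p) :
    IsFacet (polyhedron g) (polyhedronFace g i) := by
  have apply_eq : ∀ y, g i y = (g i).linear y + g i 0 := fun y => by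
    simpa using (g i).map_vadd 0 y
  refine ⟨⟨-(g i).linear, g i 0, fun y hy => ?_, ?_⟩,
    ⟨p, mem_polyhedronFace_of_forall_ne hi fun j hj => (hne j hj).le⟩, ?_⟩
  · have := hy i
    rw [apply_eq] at this
    rw [LinearMap.neg_apply]
    linarith
  · ext y
    refine and_congr_right fun _ => ?_
    rw [apply_eq, LinearMap.neg_apply, neg_eq_iff_add_eq_zero]
  · rw [vectorSpan_polyhedron_eq_top hx, finrank_top, vectorSpan_polyhedronFace hi hne]
    exact Module.Dual.finrank_ker_add_one_of_ne_zero
      (linear_ne_zero_of_apply_ne (x := x) (y := p) (hi ▸ (hx i).ne'))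

/-- A facet contains no point at which all inequalities are strict: the linear form cutting it out
would be maximal at an interior point of the polyhedron, hence zero. -/
theorem exists_subset_polyhedronFace [Finite ι] {F : Set E} (hF : IsFacet (polyhedron g) F) :
    ∃ i, F ⊆ polyhedronFace g i := by
  obtain ⟨⟨l, c, hl, rfl⟩, hne, hdim⟩ := hF
  by_contra! hcon
  have hpos : ∀ i, ∃ x ∈ {x ∈ polyhedron g | l x = c}, 0 < g i x := fun i => by
    obtain ⟨x, hx, hxi⟩ := Set.not_subset.1 (hcon i)
    exact ⟨x, hx, (hx.1 i).lt_of_ne' fun h0 => hxi ⟨hx.1, h0⟩⟩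
  obtain ⟨x, hx, hxpos⟩ := exists_mem_forall_pos
    ((convex_polyhedron g).inter ((convex_singleton c).linear_preimage l)) hne
    (fun x hx => hx.1) hpos
  have l_nonpos : ∀ v, l v ≤ 0 := fun v => by
    obtain ⟨ε, hε, hmem⟩ := exists_pos_forall_nonneg hxpos v
    have hle := hl _ hmem
    rw [map_add, map_smul, smul_eq_mul, hx.2, add_le_iff_nonpos_left] at hle
    exact nonpos_of_mul_nonpos_right hle hε
  have l_eq_zero : ∀ v, l v = 0 := fun v =>
    (l_nonpos v).antisymm (by simpa using l_nonpos (-v))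
  have face_eq : {x ∈ polyhedron g | l x = c} = polyhedron g :=
    Set.sep_eq_self_iff_mem_true.2 fun y _ => by rw [← hx.2, l_eq_zero, l_eq_zero]
  rw [face_eq] at hdim
  omega

theorem exists_eq_polyhedronFace [Finite ι] [FiniteDimensional ℝ E] (hx : ∀ i, 0 < g i x)
    {F : Set E} (hF : IsFacet (polyhedron g) F) : ∃ i, F = polyhedronFace g i := by
  obtain ⟨i, hsub⟩ := exists_subset_polyhedronFace hF
  obtain ⟨⟨l, c, -, rfl⟩, ⟨p, hp⟩, hdim⟩ := hF
  rw [vectorSpan_polyhedron_eq_top hx, finrank_top] at hdim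
  have span_eq_ker : ∀ m : E →ₗ[ℝ] ℝ, m ≠ 0 →
      vectorSpan ℝ {x ∈ polyhedron g | l x = c} ≤ LinearMap.ker m →
      vectorSpan ℝ {x ∈ polyhedron g | l x = c} = LinearMap.ker m := fun m hm hle =>
    Submodule.eq_of_le_of_finrank_eq hle (Nat.add_right_cancel
      (hdim.trans (Module.Dual.finrank_ker_add_one_of_ne_zero hm).symm))
  have hgi : (g i).linear ≠ 0 :=
    linear_ne_zero_of_apply_ne (x := x) (y := p) ((hsub hp).2 ▸ (hx i).ne')
  have span_eq_ker_gi := span_eq_ker _ hgi (vectorSpan_le_ker_linear fun y hy => (hsub hy).2)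
  refine ⟨i, hsub.antisymm fun y hy => ⟨hy.1, ?_⟩⟩
  have hyp : y - p ∈ LinearMap.ker (g i).linear := by
    rw [LinearMap.mem_ker, ← vsub_eq_sub, (g i).linearMap_vsub, hy.2, (hsub hp).2, vsub_self]
  rw [← span_eq_ker_gi] at hyp
  have := vectorSpan_le_ker_linear (g := l.toAffineMap) (fun z hz => hz.2) hyp
  rw [l.toAffineMap_linear, LinearMap.mem_ker, map_sub, sub_eq_zero] at this
  exact this.trans hp.2

namespace IsIrredundant

theorem exists_forall_pos [Finite ι] [Nontrivial ι] (hg : IsIrredundant g) :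
    ∃ x, ∀ i, 0 < g i x := by
  choose p hp hpos using hg
  have hmem : ∀ i, p i ∈ polyhedron g := fun i =>
    (mem_polyhedronFace_of_forall_ne (hp i) fun j hj => (hpos i j hj).le).1
  obtain ⟨x, -, hx⟩ := exists_mem_forall_pos (convex_polyhedron g)
    ⟨p (Classical.arbitrary ι), hmem _⟩ subset_rfl fun i =>
      let ⟨j, hj⟩ := exists_ne i
      ⟨p j, hmem j, hpos j i hj.symm⟩
  exact ⟨x, hx⟩

theorem isFacet_iff [Finite ι] [Nontrivial ι] [FiniteDimensional ℝ E] (hg : IsIrredundant g)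
    {F : Set E} : IsFacet (polyhedron g) F ↔ ∃ i, F = polyhedronFace g i := by
  obtain ⟨x, hx⟩ := hg.exists_forall_pos
  refine ⟨exists_eq_polyhedronFace hx, ?_⟩
  rintro ⟨i, rfl⟩
  obtain ⟨p, hp, hpos⟩ := hg i
  exact isFacet_polyhedronFace hx hp hpos

theorem polyhedronFace_injective (hg : IsIrredundant g) :
    Function.Injective (polyhedronFace g) := fun i j hij => by
  obtain ⟨p, hp, hpos⟩ := hg i
  have hmem : p ∈ polyhedronFace g j :=
    hij ▸ mem_polyhedronFace_of_forall_ne hp fun k hk => (hpos k hk).le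
  by_contra! hne
  exact (hpos j hne.symm).ne' hmem.2

theorem ncard_setOf_isFacet [Finite ι] [Nontrivial ι] [FiniteDimensional ℝ E]
    (hg : IsIrredundant g) : {F | IsFacet (polyhedron g) F}.ncard = Nat.card ι := by
  have facets_eq : {F | IsFacet (polyhedron g) F} = Set.range (polyhedronFace g) := by
    ext F
    simp only [hg.isFacet_iff, Set.mem_ofPred_eq, Set.mem_range, eq_comm]
  rw [facets_eq, ← Set.image_univ, Set.ncard_image_of_injective _ hg.polyhedronFace_injective,
    Set.ncard_univ]

theorem polyhedron_ne [Finite ι] [Nontrivial ι] (hg : IsIrredundant g) (i : ι) :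
    polyhedron g ≠ {x | ∀ j ≠ i, 0 ≤ g j x} := fun h => by
  obtain ⟨x, hx⟩ := hg.exists_forall_pos
  obtain ⟨p, hp, hpos⟩ := hg i
  obtain ⟨ε, hε, hmem⟩ := exists_pos_forall_nonneg (g := fun j : {j // j ≠ i} => g j)
    (fun j => hpos j j.2) (p - x)
  have hP : ε • (p - x) + p ∈ polyhedron g := h ▸ fun j hj => hmem ⟨j, hj⟩
  have := hP i
  rw [affineMap_smul_add_apply, ← vsub_eq_sub, (g i).linearMap_vsub, hp, vsub_eq_sub] at this
  linarith [mul_pos hε (hx i)]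

end IsIrredundant

end Polyhedron

section Lines

/-- The number `2 ^ a - a + n` of stable sets of the complete split graph with a stable set of `a`
vertices and a clique of `n - a` vertices: the height of the lower vertex of `polyG n` above `a`. -/
noncomputable def vertexHeight (n a : ℕ) : ℝ := 2 ^ a - a + n

variable {n k j : ℕ} {x : ℝ}

theorem lowerLine_left (n k : ℕ) : lowerLine n k k = vertexHeight n k := by
  unfold lowerLine vertexHeight
  ring

theorem lowerLine_right (n k : ℕ) : lowerLine n k (k + 1) = vertexHeight n (k + 1) := by
  unfold lowerLine vertexHeight
  push_cast
  ring

theorem lowerLine_succ (n k : ℕ) (x : ℝ) :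
    lowerLine n (k + 1) x = lowerLine n k x + 2 ^ k * (x - (k + 1)) := by
  unfold lowerLine
  push_cast
  ring

theorem lowerLine_le_of_le_index (hjk : j ≤ k) (hkx : k ≤ x) :
    lowerLine n j x ≤ lowerLine n k x := by
  induction k, hjk using Nat.le_induction with
  | base => exact le_rfl
  | succ k _ ih =>
    push_cast at hkx
    have step : 0 ≤ 2 ^ k * (x - (k + 1)) := mul_nonneg (by positivity) (by linarith)
    linarith [ih (by linarith), lowerLine_succ n k x]

theorem lowerLine_lt_of_lt_index (hjk : j < k) (hkx : k < x) :
    lowerLine n j x < lowerLine n k x := by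
  obtain ⟨k, rfl⟩ := Nat.exists_eq_add_one_of_ne_zero (Nat.ne_zero_of_lt hjk)
  push_cast at hkx
  have step : 0 < 2 ^ k * (x - (k + 1)) := mul_pos (by positivity) (by linarith)
  linarith [lowerLine_le_of_le_index (n := n) (Nat.le_of_lt_succ hjk)
    (show (k : ℝ) ≤ x by linarith), lowerLine_succ n k x]

theorem lowerLine_le_of_index_le (hkj : k ≤ j) (hxk : x ≤ k + 1) :
    lowerLine n j x ≤ lowerLine n k x := by
  induction j, hkj using Nat.le_induction with
  | base => exact le_rfl
  | succ j hkj ih =>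
    have hkj' : (k : ℝ) ≤ j := Nat.cast_le.2 hkj
    have step : 2 ^ j * (x - (j + 1)) ≤ 0 :=
      mul_nonpos_of_nonneg_of_nonpos (by positivity) (by linarith)
    linarith [lowerLine_succ n j x]

theorem lowerLine_lt_of_index_lt (hkj : k < j) (hxk : x < k + 1) :
    lowerLine n j x < lowerLine n k x := by
  have step : 2 ^ k * (x - (k + 1)) < 0 := mul_neg_of_pos_of_neg (by positivity) (by linarith)
  linarith [lowerLine_le_of_index_le (n := n) (k := k + 1) hkj
    (show x ≤ (k + 1 : ℕ) + 1 by push_cast; linarith), lowerLine_succ n k x]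

theorem lowerLine_lt_of_ne (hkx : k < x) (hxk : x < k + 1) (hjk : j ≠ k) :
    lowerLine n j x < lowerLine n k x := by
  rcases hjk.lt_or_gt with h | h
  · exact lowerLine_lt_of_lt_index h hkx
  · exact lowerLine_lt_of_index_lt h hxk

theorem lowerLine_le_vertexHeight (n k a : ℕ) : lowerLine n k a ≤ vertexHeight n a := by
  rw [← lowerLine_left]
  rcases le_total k a with h | h
  · exact lowerLine_le_of_le_index h le_rfl
  · exact lowerLine_le_of_index_le h (by linarith)

theorem upperLine_one (n : ℕ) : upperLine n 1 = vertexHeight n 1 := by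
  unfold upperLine vertexHeight
  push_cast
  ring

theorem upperLine_self (hn : 2 ≤ n) : upperLine n n = vertexHeight n n := by
  have hn' : (2 : ℝ) ≤ n := by exact_mod_cast hn
  unfold upperLine vertexHeight
  rw [div_mul_cancel₀ _ (by linarith)]
  ring

theorem upperLine_sub_lowerLine_mul (hn : 2 ≤ n) (k : ℕ) (x : ℝ) :
    (upperLine n x - lowerLine n k x) * (n - 1) =
      (vertexHeight n 1 - lowerLine n k 1) * (n - x) +
        (vertexHeight n n - lowerLine n k n) * (x - 1) := by
  rw [← upperLine_one, ← upperLine_self hn]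
  unfold upperLine lowerLine
  ring

theorem lowerLine_one_lt_vertexHeight_self (hn : 3 ≤ n) : lowerLine n 1 n < vertexHeight n n := by
  obtain ⟨m, rfl⟩ := Nat.exists_eq_add_of_le' (Nat.one_le_of_lt hn)
  rw [Nat.cast_succ, ← lowerLine_right]
  exact lowerLine_lt_of_lt_index (by omega) (by linarith)

theorem lowerLine_lt_vertexHeight_one (hk : 2 ≤ k) : lowerLine n k 1 < vertexHeight n 1 := by
  rw [← lowerLine_left, Nat.cast_one]
  exact lowerLine_lt_of_index_lt hk (by norm_num)

theorem lowerLine_lt_upperLine (hn : 3 ≤ n) (hk : 1 ≤ k) (h1x : 1 < x) (hxn : x < n) :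
    lowerLine n k x < upperLine n x := by
  have left_nonneg := lowerLine_le_vertexHeight n k 1
  have right_nonneg := lowerLine_le_vertexHeight n k n
  rw [Nat.cast_one] at left_nonneg
  refine sub_pos.1 (pos_of_mul_pos_left (b := (n : ℝ) - 1) ?_ (by linarith))
  rw [upperLine_sub_lowerLine_mul (by omega)]
  rcases hk.eq_or_lt with rfl | hk
  · exact add_pos_of_nonneg_of_pos (mul_nonneg (by linarith) (by linarith))
      (mul_pos (sub_pos.2 (lowerLine_one_lt_vertexHeight_self hn)) (by linarith))
  · exact add_pos_of_pos_of_nonneg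
      (mul_pos (sub_pos.2 (lowerLine_lt_vertexHeight_one hk)) (by linarith))
      (mul_nonneg (by linarith) (by linarith))

theorem one_le_of_lowerLine_le_upperLine (hn : 3 ≤ n) (h : lowerLine n 1 x ≤ upperLine n x) :
    1 ≤ x := by
  have hn' : (3 : ℝ) ≤ n := by exact_mod_cast hn
  have gap := upperLine_sub_lowerLine_mul (n := n) (by omega) 1 x
  have left_eq : lowerLine n 1 1 = vertexHeight n 1 := by simpa using lowerLine_left n 1
  rw [left_eq, sub_self, zero_mul, zero_add] at gap
  have gap_nonneg : 0 ≤ (vertexHeight n n - lowerLine n 1 n) * (x - 1) :=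
    gap ▸ mul_nonneg (sub_nonneg.2 h) (by linarith)
  exact sub_nonneg.1 (nonneg_of_mul_nonneg_right gap_nonneg
    (sub_pos.2 (lowerLine_one_lt_vertexHeight_self hn)))

theorem le_of_lowerLine_le_upperLine (hn : 3 ≤ n)
    (h : lowerLine n (n - 1) x ≤ upperLine n x) : x ≤ n := by
  have hn' : (3 : ℝ) ≤ n := by exact_mod_cast hn
  have gap := upperLine_sub_lowerLine_mul (n := n) (by omega) (n - 1) x
  have right_eq : lowerLine n (n - 1) n = vertexHeight n n := by
    have := lowerLine_right n (n - 1)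
    rwa [Nat.cast_pred (by omega), sub_add_cancel, Nat.sub_add_cancel (by omega)] at this
  rw [right_eq, sub_self, zero_mul, add_zero] at gap
  have gap_nonneg : 0 ≤ (vertexHeight n 1 - lowerLine n (n - 1) 1) * (n - x) :=
    gap ▸ mul_nonneg (sub_nonneg.2 h) (by linarith)
  exact sub_nonneg.1 (nonneg_of_mul_nonneg_right gap_nonneg
    (sub_pos.2 (lowerLine_lt_vertexHeight_one (by omega))))

theorem cube_le_pow_two (hn : 5 ≤ n) : n ^ 3 + 4 * n + 4 ≤ 4 * 2 ^ n + n ^ 2 := by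
  induction n, hn using Nat.le_induction with
  | base => norm_num
  | succ n hn ih =>
    rw [pow_succ 2]
    obtain ⟨m, rfl⟩ := Nat.exists_eq_add_of_le hn
    nlinarith [Nat.zero_le (m ^ 3), Nat.zero_le (m ^ 2)]

theorem add_two_sq_le_upperLine (hn : 5 ≤ n) : ((n : ℝ) + 2) ^ 2 ≤ 4 * upperLine n 2 := by
  have hn' : (5 : ℝ) ≤ n := by exact_mod_cast hn
  have hcube : (n : ℝ) ^ 3 + 4 * n + 4 ≤ 4 * 2 ^ n + n ^ 2 := by exact_mod_cast cube_le_pow_two hn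
  have hslope : (n : ℝ) ^ 2 / 4 ≤ (2 ^ n - n - 1) / (n - 1) := by
    rw [le_div_iff₀ (by linarith)]
    linarith
  unfold upperLine
  linarith

theorem three_halves_pow_mul_le (hn : 5 ≤ n) :
    (32 / 27 : ℝ) * (3 / 2) ^ n * (n - 1) ≤ 2 ^ n + 4 := by
  induction n, hn using Nat.le_induction with
  | base => norm_num
  | succ n hn ih =>
    have hn' : (5 : ℝ) ≤ n := by exact_mod_cast hn
    have hpow : (9 : ℝ) ≤ 32 / 27 * (3 / 2) ^ n := by
      linarith [pow_le_pow_right₀ (show (1 : ℝ) ≤ 3 / 2 by norm_num) hn]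
    rw [pow_succ, pow_succ]
    push_cast
    nlinarith

theorem four_thirds_cube_mul_pow_le_upperLine (hn : 5 ≤ n) :
    (4 / 3 : ℝ) ^ 3 * (3 / 2) ^ n ≤ upperLine n 3 := by
  have hn' : (5 : ℝ) ≤ n := by exact_mod_cast hn
  have hbound : ((4 / 3 : ℝ) ^ 3 * (3 / 2) ^ n - (n + 1)) / 2 ≤ (2 ^ n - n - 1) / (n - 1) := by
    rw [le_div_iff₀ (by linarith)]
    nlinarith [three_halves_pow_mul_le hn]
  unfold upperLine
  linarith

theorem concaveOn_upperLine (n : ℕ) : ConcaveOn ℝ Set.univ (upperLine n) := by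
  refine ⟨convex_univ, fun x _ y _ u v _ _ huv => le_of_eq ?_⟩
  simp only [upperLine, smul_eq_mul]
  linear_combination (n + 1 - ((2 : ℝ) ^ n - n - 1) / (n - 1)) * huv

/-- The left-hand side is convex in `a`, so it is enough to compare at `a = 3` and `a = n`. -/
theorem four_thirds_pow_mul_le_upperLine {a : ℕ} (hn : 5 ≤ n) (ha : 3 ≤ a) (han : a ≤ n) :
    (4 / 3 : ℝ) ^ a * (3 / 2) ^ n ≤ upperLine n a := by
  have hconv : ConvexOn ℝ Set.univ
      fun x : ℝ => (3 / 2 : ℝ) ^ n * (4 / 3 : ℝ) ^ x - upperLine n x :=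
    ((convexOn_rpow_left (by norm_num)).smul (by positivity)).sub (concaveOn_upperLine n)
  have hmax := hconv.le_max_of_mem_Icc (x := ((3 : ℕ) : ℝ)) (y := (n : ℝ)) (z := (a : ℝ))
    trivial trivial ⟨by exact_mod_cast ha, by exact_mod_cast han⟩
  simp only [Real.rpow_natCast] at hmax
  have at_three : (3 / 2 : ℝ) ^ n * (4 / 3) ^ 3 - upperLine n (3 : ℕ) ≤ 0 := by
    rw [Nat.cast_ofNat]
    linarith [four_thirds_cube_mul_pow_le_upperLine hn]
  have at_n : (3 / 2 : ℝ) ^ n * (4 / 3) ^ n - upperLine n n ≤ 0 := by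
    rw [upperLine_self (by omega), ← mul_pow, vertexHeight]
    norm_num
  linarith [hmax.trans (max_le at_three at_n)]

end Lines

section IndepSubsets

open Finset

variable {V : Type*} {G : SimpleGraph V} {S t : Finset V} {v : V}

open Classical in
/-- The stable sets of `G` contained in `S`, as a finset; `fibonacciIndex` counts those of the
whole vertex set, and subsets `S` are needed to argue by deleting vertices. -/
noncomputable def indepSubsets (G : SimpleGraph V) (S : Finset V) : Finset (Finset V) :=
  {t ∈ S.powerset | G.IsIndepSet t}

theorem mem_indepSubsets : t ∈ indepSubsets G S ↔ t ⊆ S ∧ G.IsIndepSet t := by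
  simp only [indepSubsets, mem_filter, mem_powerset]

theorem card_indepSubsets_le_two_pow (G : SimpleGraph V) (S : Finset V) :
    #(indepSubsets G S) ≤ 2 ^ #S :=
  (card_le_card fun _ ht => mem_powerset.2 (mem_indepSubsets.1 ht).1).trans (card_powerset S).le

theorem fibonacciIndex_eq_card_indepSubsets [Fintype V] (G : SimpleGraph V) :
    fibonacciIndex G = #(indepSubsets G univ) := by
  rw [fibonacciIndex, ← Set.ncard_coe_finset]
  congr 1
  ext t
  simp [mem_indepSubsets]

section DeleteVertex

variable [DecidableEq V] [DecidableRel G.Adj]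

theorem card_indepSubsets_le_add (S : Finset V) (v : V) :
    #(indepSubsets G S) ≤
      #(indepSubsets G (S.erase v)) + #(indepSubsets G {w ∈ S.erase v | ¬ G.Adj v w}) := by
  suffices indepSubsets G S ⊆ indepSubsets G (S.erase v) ∪
      (indepSubsets G {w ∈ S.erase v | ¬ G.Adj v w}).image (insert v) from
    (card_le_card this).trans
      ((card_union_le _ _).trans (Nat.add_le_add_left card_image_le _))
  intro t ht
  obtain ⟨htS, ht⟩ := mem_indepSubsets.1 ht
  rw [mem_union, mem_image]
  by_cases hv : v ∈ t
  · refine Or.inr ⟨t.erase v, mem_indepSubsets.2 ⟨fun w hw => ?_, ht.mono (by simp)⟩,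
      insert_erase hv⟩
    obtain ⟨hwv, hwt⟩ := mem_erase.1 hw
    exact mem_filter.2 ⟨mem_erase.2 ⟨hwv, htS hwt⟩, ht hv hwt hwv.symm⟩
  · exact Or.inl (mem_indepSubsets.2 ⟨subset_erase.2 ⟨htS, hv⟩, ht⟩)

theorem card_add_one_le_of_forall_isIndepSet {a : ℕ}
    (h : ∀ t ⊆ S, G.IsIndepSet t → #t ≤ a) (hv : v ∈ S)
    (htS : t ⊆ {w ∈ S.erase v | ¬ G.Adj v w}) (ht : G.IsIndepSet t) : #t + 1 ≤ a := by
  have of_mem : ∀ w ∈ t, (w ≠ v ∧ w ∈ S) ∧ ¬ G.Adj v w := fun w hw => by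
    simpa only [mem_filter, mem_erase] using htS hw
  have hvt : v ∉ t := fun hvt => (of_mem v hvt).1.1 rfl
  rw [← card_insert_of_notMem hvt]
  refine h _ (insert_subset hv fun w hw => (of_mem w hw).1.2) ?_
  rw [coe_insert]
  exact ht.insert fun w hw _ => ⟨(of_mem w hw).2, fun hwv => (of_mem w hw).2 hwv.symm⟩

theorem card_filter_not_adj_add_two_le {w : V} (hv : v ∈ S) (hw : w ∈ S) (hadj : G.Adj v w) :
    #{u ∈ S.erase v | ¬ G.Adj v u} + 2 ≤ #S := by
  have hw' : w ∈ S.erase v := mem_erase.2 ⟨hadj.ne', hw⟩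
  have lt_erase : #{u ∈ S.erase v | ¬ G.Adj v u} < #(S.erase v) :=
    card_lt_card (filter_ssubset.2 ⟨w, hw', not_not.2 hadj⟩)
  have := card_erase_add_one hv
  omega

end DeleteVertex

/-- The bound is attained by disjoint unions of edges and isolated vertices, which is where the
constants `4 / 3` and `3 / 2` come from. -/
theorem card_indepSubsets_le_pow_mul_pow {a : ℕ} (h : ∀ t ⊆ S, G.IsIndepSet t → #t ≤ a) :
    (#(indepSubsets G S) : ℝ) ≤ (4 / 3) ^ a * (3 / 2) ^ #S := by
  classical
  induction S using Finset.strongInduction generalizing a with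
  | H S ih =>
  by_cases hS : G.IsIndepSet (S : Set V)
  · calc (#(indepSubsets G S) : ℝ) ≤ 2 ^ #S := by exact_mod_cast card_indepSubsets_le_two_pow G S
      _ = (4 / 3) ^ #S * (3 / 2) ^ #S := by rw [← mul_pow]; norm_num
      _ ≤ (4 / 3) ^ a * (3 / 2) ^ #S := by
          gcongr
          · norm_num
          · exact h S subset_rfl hS
  · obtain ⟨v, hv, w, hw, -, hadj⟩ : ∃ v ∈ S, ∃ w ∈ S, v ≠ w ∧ G.Adj v w := by
      simpa [SimpleGraph.isIndepSet_iff, Set.Pairwise] using hS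
    set T : Finset V := {u ∈ S.erase v | ¬ G.Adj v u}
    have hT : ∀ t ⊆ T, G.IsIndepSet t → #t + 1 ≤ a := fun t htT ht =>
      card_add_one_le_of_forall_isIndepSet h hv htT ht
    obtain ⟨b, rfl⟩ : ∃ b, a = b + 1 := Nat.exists_eq_add_of_le' (hT ∅ (empty_subset _) (by simp))
    have card_T : #T + 2 ≤ #S := card_filter_not_adj_add_two_le hv hw hadj
    obtain ⟨m, hm⟩ : ∃ m, #S = m + 2 := Nat.exists_eq_add_of_le' (by omega)
    have bound_erase := ih (S.erase v) (erase_ssubset hv)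
      fun t ht => h t (ht.trans (erase_subset _ _))
    have bound_T := ih T ((filter_subset _ _).trans_ssubset (erase_ssubset hv))
      fun t htT ht => Nat.le_of_succ_le_succ (hT t htT ht)
    calc (#(indepSubsets G S) : ℝ)
        ≤ #(indepSubsets G (S.erase v)) + #(indepSubsets G T) := by
          exact_mod_cast card_indepSubsets_le_add S v
      _ ≤ (4 / 3) ^ (b + 1) * (3 / 2) ^ (m + 1) + (4 / 3) ^ b * (3 / 2) ^ m := by
          rw [card_erase_of_mem hv, hm] at bound_erase
          refine add_le_add bound_erase (bound_T.trans ?_)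
          gcongr
          · norm_num
          · omega
      _ = (4 / 3) ^ (b + 1) * (3 / 2) ^ #S := by rw [hm]; ring

end IndepSubsets

section FibonacciIndex

open Finset SimpleGraph

variable {V : Type*} {G : SimpleGraph V}

theorem indepNum_pos [Finite V] [Nonempty V] (G : SimpleGraph V) : 0 < G.indepNum :=
  Nat.one_le_of_lt (IsIndepSet.card_le_indepNum (t := {Classical.arbitrary V}) (by simp))

theorem indepNum_le_card [Fintype V] (G : SimpleGraph V) : G.indepNum ≤ Fintype.card V := by
  obtain ⟨s, hs⟩ := G.exists_isNIndepSet_indepNum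
  exact hs.card_eq ▸ s.card_le_univ

theorem fibonacciIndex_anti [Finite V] : Antitone (fibonacciIndex (V := V)) := fun _ _ hGH =>
  Set.ncard_le_ncard fun _ ht _ hv _ hw hvw hadj => ht hv hw hvw (hGH hadj)

theorem fibonacciIndex_le_pow_mul_pow [Fintype V] (G : SimpleGraph V) :
    (fibonacciIndex G : ℝ) ≤ (4 / 3) ^ G.indepNum * (3 / 2) ^ Fintype.card V := by
  rw [fibonacciIndex_eq_card_indepSubsets]
  exact card_indepSubsets_le_pow_mul_pow fun t _ ht => ht.card_le_indepNum

theorem fibonacciIndex_le_card_add_card_edgeFinset_compl [Fintype V] [DecidableEq V]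
    [DecidableRel G.Adj] (h : G.indepNum ≤ 2) :
    fibonacciIndex G ≤ Fintype.card V + 1 + #Gᶜ.edgeFinset := by
  suffices indepSubsets G univ ⊆
      insert ∅ (univ.image fun v : V => {v}) ∪ Gᶜ.edgeFinset.image Sym2.toFinset by
    rw [fibonacciIndex_eq_card_indepSubsets]
    exact (card_le_card this).trans ((card_union_le _ _).trans (add_le_add
      ((card_insert_le _ _).trans (Nat.add_le_add_right card_image_le _)) card_image_le))
  intro t ht
  have indep := (mem_indepSubsets.1 ht).2
  have card_le := indep.card_le_indepNum.trans h
  simp only [mem_union, mem_insert, mem_image, mem_univ, true_and]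
  interval_cases hcard : #t
  · exact Or.inl (Or.inl (card_eq_zero.1 hcard))
  · obtain ⟨v, rfl⟩ := card_eq_one.1 hcard
    exact Or.inl (Or.inr ⟨v, rfl⟩)
  · obtain ⟨v, w, hvw, rfl⟩ := card_eq_two.1 hcard
    refine Or.inr ⟨s(v, w), ?_, Sym2.toFinset_mk_eq⟩
    rw [mem_edgeFinset, mem_edgeSet, compl_adj]
    exact ⟨hvw, indep (by simp) (by simp) hvw⟩

theorem two_mul_indepNum_mul_card_edgeFinset_compl_le [Fintype V] [DecidableEq V]
    [DecidableRel G.Adj] :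
    2 * G.indepNum * #Gᶜ.edgeFinset ≤ (G.indepNum - 1) * Fintype.card V ^ 2 := by
  have cliqueFree : Gᶜ.CliqueFree (G.indepNum + 1) := fun t ht => by
    have card_le := ((isNClique_compl G).1 ht).isIndepSet.card_le_indepNum
    rw [ht.card_eq] at card_le
    omega
  have turan_bound := cliqueFree.card_edgeFinset_le
  dsimp only at turan_bound
  rw [← card_edgeFinset_turanGraph] at turan_bound
  exact (Nat.mul_le_mul_left _ turan_bound).trans mul_card_edgeFinset_turanGraph_le

theorem fibonacciIndex_le_of_indepNum_eq_one [Fintype V] (h : G.indepNum = 1) :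
    fibonacciIndex G ≤ Fintype.card V + 1 := by
  classical
  have count := fibonacciIndex_le_card_add_card_edgeFinset_compl (h.trans_le one_le_two)
  have turan := two_mul_indepNum_mul_card_edgeFinset_compl_le (G := G)
  rw [h] at turan
  omega

theorem four_mul_fibonacciIndex_le_of_indepNum_eq_two [Fintype V] (h : G.indepNum = 2) :
    4 * fibonacciIndex G ≤ (Fintype.card V + 2) ^ 2 := by
  classical
  have count := fibonacciIndex_le_card_add_card_edgeFinset_compl h.le
  have turan := two_mul_indepNum_mul_card_edgeFinset_compl_le (G := G)
  rw [h] at turan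
  linarith

theorem fibonacciIndex_le_upperLine [Fintype V] (G : SimpleGraph V) (hV : 5 ≤ Fintype.card V) :
    (fibonacciIndex G : ℝ) ≤ upperLine (Fintype.card V) G.indepNum := by
  have : Nonempty V := Fintype.card_pos_iff.1 (by omega)
  obtain one | two | three_le : G.indepNum = 1 ∨ G.indepNum = 2 ∨ 3 ≤ G.indepNum := by
    have := indepNum_pos G
    omega
  · have bound : (fibonacciIndex G : ℝ) ≤ Fintype.card V + 1 := by
      exact_mod_cast fibonacciIndex_le_of_indepNum_eq_one one
    rw [one, Nat.cast_one, upperLine_one, vertexHeight]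
    norm_num
    linarith
  · have bound : (4 * fibonacciIndex G : ℝ) ≤ (Fintype.card V + 2) ^ 2 := by
      exact_mod_cast four_mul_fibonacciIndex_le_of_indepNum_eq_two two
    rw [two, Nat.cast_ofNat]
    linarith [add_two_sq_le_upperLine hV]
  · exact (fibonacciIndex_le_pow_mul_pow G).trans
      (four_thirds_pow_mul_le_upperLine hV three_le (indepNum_le_card G))

end FibonacciIndex

section CompleteSplitGraph

open Finset SimpleGraph

variable {V : Type*}

/-- The complete split graph with stable side `s`: two distinct vertices are adjacent unless both
lie in `s`. It is the largest graph in which `s` is stable. -/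
def completeSplitGraph (s : Set V) : SimpleGraph V where
  Adj v w := v ≠ w ∧ ¬ (v ∈ s ∧ w ∈ s)
  symm := ⟨fun _ _ h => ⟨h.1.symm, fun h' => h.2 h'.symm⟩⟩
  loopless := ⟨fun _ h => h.1 rfl⟩

theorem le_completeSplitGraph {G : SimpleGraph V} {s : Set V} (hs : G.IsIndepSet s) :
    G ≤ completeSplitGraph s :=
  fun _ _ hadj => ⟨hadj.ne, fun h => hs h.1 h.2 hadj.ne hadj⟩

theorem isIndepSet_completeSplitGraph_iff {s t : Set V} :
    (completeSplitGraph s).IsIndepSet t ↔ t ⊆ s ∨ t.Subsingleton := by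
  constructor
  · refine fun ht => or_iff_not_imp_left.2 fun hts => ?_
    obtain ⟨v, hv, hvs⟩ := Set.not_subset.1 hts
    have eq_v : ∀ w ∈ t, w = v := fun w hw => by
      by_contra hne
      exact ht hw hv hne ⟨hne, fun h => hvs h.2⟩
    exact fun x hx y hy => (eq_v x hx).trans (eq_v y hy).symm
  · rintro (hts | hts) v hv w hw hne hadj
    · exact hadj.2 ⟨hts hv, hts hw⟩
    · exact hne (hts hv hw)

theorem indepNum_completeSplitGraph [Finite V] {s : Finset V} (hs : s.Nonempty) :
    (completeSplitGraph (s : Set V)).indepNum = #s := by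
  refine le_antisymm ?_
    (IsIndepSet.card_le_indepNum (isIndepSet_completeSplitGraph_iff.2 (Or.inl subset_rfl)))
  obtain ⟨t, ht⟩ := (completeSplitGraph (s : Set V)).exists_isNIndepSet_indepNum
  rw [← ht.card_eq]
  rcases isIndepSet_completeSplitGraph_iff.1 ht.isIndepSet with hts | hts
  · exact card_le_card (coe_subset.1 hts)
  · exact (card_le_one_iff_subsingleton.2 hts).trans hs.card_pos

variable [Fintype V]

theorem indepSubsets_completeSplitGraph [DecidableEq V] (s : Finset V) :
    indepSubsets (completeSplitGraph (s : Set V)) univ =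
      s.powerset ∪ sᶜ.image fun v => {v} := by
  ext t
  simp only [mem_indepSubsets, subset_univ, true_and, isIndepSet_completeSplitGraph_iff,
    coe_subset, mem_union, mem_powerset, mem_image, mem_compl]
  refine or_congr_right' fun hts => ⟨fun ht => ?_, ?_⟩
  · obtain ⟨v, hv, hvs⟩ := not_subset.1 hts
    exact ⟨v, hvs, coe_injective (by simp [ht.eq_singleton_of_mem hv])⟩
  · rintro ⟨v, -, rfl⟩
    simp

theorem fibonacciIndex_completeSplitGraph (s : Finset V) :
    (fibonacciIndex (completeSplitGraph (s : Set V)) : ℝ) = vertexHeight (Fintype.card V) #s := by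
  classical
  have hdis : Disjoint s.powerset (sᶜ.image fun v : V => {v}) := by
    rw [Finset.disjoint_right]
    simp only [mem_image, mem_compl, mem_powerset]
    rintro _ ⟨v, hv, rfl⟩ hvs
    exact hv (singleton_subset_iff.1 hvs)
  rw [fibonacciIndex_eq_card_indepSubsets, indepSubsets_completeSplitGraph,
    card_union_of_disjoint hdis, card_powerset, card_image_of_injective _ singleton_injective,
    card_compl, Nat.cast_add, Nat.cast_sub s.card_le_univ, vertexHeight]
  push_cast
  ring

theorem vertexHeight_le_fibonacciIndex (G : SimpleGraph V) :
    vertexHeight (Fintype.card V) G.indepNum ≤ fibonacciIndex G := by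
  obtain ⟨s, hs⟩ := G.exists_isNIndepSet_indepNum
  rw [← hs.card_eq, ← fibonacciIndex_completeSplitGraph]
  exact_mod_cast fibonacciIndex_anti (le_completeSplitGraph hs.isIndepSet)

theorem lowerLine_le_fibonacciIndex (G : SimpleGraph V) (k : ℕ) :
    lowerLine (Fintype.card V) k G.indepNum ≤ fibonacciIndex G :=
  (lowerLine_le_vertexHeight _ _ _).trans (vertexHeight_le_fibonacciIndex G)

end CompleteSplitGraph

section Polygon

variable {n : ℕ}

/-- `lowerLine n k` as an affine map, to express the polygon as a `polyhedron`. -/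
def lowerLineAffineMap (n k : ℕ) : ℝ →ᵃ[ℝ] ℝ where
  toFun := lowerLine n k
  linear := ((2 : ℝ) ^ k - 1) • LinearMap.id
  map_vadd' x v := by simp only [lowerLine, vadd_eq_add, LinearMap.smul_apply,
    LinearMap.id_apply, smul_eq_mul]; ring

theorem lowerLineAffineMap_apply (n k : ℕ) (x : ℝ) : lowerLineAffineMap n k x = lowerLine n k x :=
  rfl

/-- `upperLine n` as an affine map, to express the polygon as a `polyhedron`. -/
noncomputable def upperLineAffineMap (n : ℕ) : ℝ →ᵃ[ℝ] ℝ where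
  toFun := upperLine n
  linear := (((2 : ℝ) ^ n - n - 1) / (n - 1)) • LinearMap.id
  map_vadd' x v := by simp only [upperLine, vadd_eq_add, LinearMap.smul_apply,
    LinearMap.id_apply, smul_eq_mul]; ring

theorem upperLineAffineMap_apply (n : ℕ) (x : ℝ) : upperLineAffineMap n x = upperLine n x :=
  rfl

/-- The `n` inequalities of the theorem as affine forms required to be nonnegative: `some k` is the
`k`-th lower inequality and `none` the upper one. -/
noncomputable def inequalitySlack (n : ℕ) : Option (Set.Icc 1 (n - 1)) → (ℝ × ℝ →ᵃ[ℝ] ℝ)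
  | some k => AffineMap.snd - (lowerLineAffineMap n k).comp AffineMap.fst
  | none => (upperLineAffineMap n).comp AffineMap.fst - AffineMap.snd

theorem inequalitySlack_some_apply (k : Set.Icc 1 (n - 1)) (p : ℝ × ℝ) :
    inequalitySlack n (some k) p = p.2 - lowerLine n k p.1 :=
  rfl

theorem inequalitySlack_none_apply (p : ℝ × ℝ) :
    inequalitySlack n none p = upperLine n p.1 - p.2 :=
  rfl

theorem mem_polyhedron_inequalitySlack {p : ℝ × ℝ} :
    p ∈ polyhedron (inequalitySlack n) ↔
      (∀ k ∈ Set.Icc 1 (n - 1), lowerLine n k p.1 ≤ p.2) ∧ p.2 ≤ upperLine n p.1 := by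
  simp only [polyhedron, Set.mem_ofPred_eq, Option.forall, inequalitySlack_some_apply,
    inequalitySlack_none_apply, sub_nonneg, Subtype.forall, and_comm]

theorem polyG_subset_polyhedron (hn : 5 ≤ n) : polyG n ⊆ polyhedron (inequalitySlack n) := by
  refine convexHull_min ?_ (convex_polyhedron _)
  rintro ⟨_, _⟩ ⟨G, rfl, rfl⟩
  refine mem_polyhedron_inequalitySlack.2 ⟨fun k _ => ?_, ?_⟩
  · simpa using lowerLine_le_fibonacciIndex G k
  · simpa using fibonacciIndex_le_upperLine G (by simpa using hn)

theorem vertex_mem_polyG {a : ℕ} (ha : 1 ≤ a) (han : a ≤ n) :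
    ((a : ℝ), vertexHeight n a) ∈ polyG n := by
  obtain ⟨s, -, hs⟩ := Finset.exists_subset_card_eq
    (show a ≤ (Finset.univ : Finset (Fin n)).card by simpa using han)
  refine subset_convexHull ℝ _ ⟨completeSplitGraph (s : Set (Fin n)), ?_, ?_⟩
  · rw [indepNum_completeSplitGraph (Finset.card_pos.1 (by omega)), hs]
  · rw [fibonacciIndex_completeSplitGraph, hs, Fintype.card_fin]

theorem affineMap_graph_mem_of_mem_Icc {s : Set (ℝ × ℝ)} (hs : Convex ℝ s) (f : ℝ →ᵃ[ℝ] ℝ)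
    {a b x : ℝ} (ha : (a, f a) ∈ s) (hb : (b, f b) ∈ s) (hx : x ∈ Set.Icc a b) :
    (x, f x) ∈ s :=
  (hs.affine_preimage ((AffineMap.id ℝ ℝ).prod f)).ordConnected.out ha hb hx

theorem vertical_mem_of_mem_Icc {s : Set (ℝ × ℝ)} (hs : Convex ℝ s) {x a b y : ℝ}
    (ha : (x, a) ∈ s) (hb : (x, b) ∈ s) (hy : y ∈ Set.Icc a b) : (x, y) ∈ s :=
  (hs.affine_preimage ((AffineMap.const ℝ ℝ x).prod (AffineMap.id ℝ ℝ))).ordConnected.out ha hb hy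

theorem lowerLine_mem_polyG {k : ℕ} {x : ℝ} (hk : 1 ≤ k) (hkn : k + 1 ≤ n)
    (hx : x ∈ Set.Icc (k : ℝ) (k + 1)) : (x, lowerLine n k x) ∈ polyG n := by
  refine affineMap_graph_mem_of_mem_Icc (convex_convexHull ℝ _) (lowerLineAffineMap n k) ?_ ?_ hx
  · rw [lowerLineAffineMap_apply, lowerLine_left]
    exact vertex_mem_polyG hk (by omega)
  · rw [lowerLineAffineMap_apply, lowerLine_right]
    exact_mod_cast vertex_mem_polyG (Nat.le_add_left 1 k) hkn

theorem upperLine_mem_polyG {x : ℝ} (hn : 2 ≤ n) (hx : x ∈ Set.Icc (1 : ℝ) n) :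
    (x, upperLine n x) ∈ polyG n := by
  refine affineMap_graph_mem_of_mem_Icc (convex_convexHull ℝ _) (upperLineAffineMap n) ?_ ?_ hx
  · rw [upperLineAffineMap_apply, upperLine_one]
    exact_mod_cast vertex_mem_polyG le_rfl (by omega)
  · rw [upperLineAffineMap_apply, upperLine_self hn]
    exact vertex_mem_polyG (by omega) le_rfl

theorem exists_nat_mem_Icc_add_one {x : ℝ} (hn : 2 ≤ n) (hx : x ∈ Set.Icc (1 : ℝ) n) :
    ∃ k : ℕ, 1 ≤ k ∧ k + 1 ≤ n ∧ x ∈ Set.Icc (k : ℝ) (k + 1) := by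
  rcases hx.2.eq_or_lt with rfl | hxn
  · refine ⟨n - 1, by omega, by omega, ?_⟩
    rw [Nat.cast_pred (by omega)]
    exact ⟨by linarith, by linarith⟩
  · have hx0 : 0 ≤ x := zero_le_one.trans hx.1
    exact ⟨⌊x⌋₊, Nat.le_floor (by simpa using hx.1), (Nat.floor_lt hx0).2 hxn,
      Nat.floor_le hx0, (Nat.lt_floor_add_one x).le⟩

theorem polyhedron_subset_polyG (hn : 3 ≤ n) : polyhedron (inequalitySlack n) ⊆ polyG n := by
  rintro ⟨x, y⟩ hp
  obtain ⟨hlower, hupper⟩ := mem_polyhedron_inequalitySlack.1 hp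
  have hx : x ∈ Set.Icc (1 : ℝ) n :=
    ⟨one_le_of_lowerLine_le_upperLine hn ((hlower 1 ⟨le_rfl, by omega⟩).trans hupper),
      le_of_lowerLine_le_upperLine hn ((hlower (n - 1) ⟨by omega, le_rfl⟩).trans hupper)⟩
  obtain ⟨k, hk, hkn, hxk⟩ := exists_nat_mem_Icc_add_one (by omega) hx
  exact vertical_mem_of_mem_Icc (convex_convexHull ℝ _) (lowerLine_mem_polyG hk hkn hxk)
    (upperLine_mem_polyG (by omega) hx) ⟨hlower k ⟨hk, by omega⟩, hupper⟩

theorem polyG_eq_polyhedron (hn : 5 ≤ n) : polyG n = polyhedron (inequalitySlack n) :=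
  (polyG_subset_polyhedron hn).antisymm (polyhedron_subset_polyG (by omega))

theorem isIrredundant_inequalitySlack (hn : 3 ≤ n) : IsIrredundant (inequalitySlack n) := by
  have hn' : (3 : ℝ) ≤ n := by exact_mod_cast hn
  rintro (_ | ⟨k, hk⟩)
  · refine ⟨(2, upperLine n 2), sub_self _, ?_⟩
    rintro (_ | ⟨j, hj⟩) hne
    · exact absurd rfl hne
    · rw [inequalitySlack_some_apply, sub_pos]
      exact lowerLine_lt_upperLine hn hj.1 (by norm_num) (by linarith)
  · have hk1 : (1 : ℝ) ≤ k := by exact_mod_cast hk.1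
    have hkn : (k : ℝ) + 1 ≤ n := by
      exact_mod_cast (Nat.le_sub_iff_add_le (by omega)).1 hk.2
    refine ⟨(k + 1 / 2, lowerLine n k (k + 1 / 2)), sub_self _, ?_⟩
    rintro (_ | ⟨j, hj⟩) hne
    · rw [inequalitySlack_none_apply, sub_pos]
      exact lowerLine_lt_upperLine hn hk.1 (by linarith) (by linarith)
    · rw [inequalitySlack_some_apply, sub_pos]
      exact lowerLine_lt_of_ne (by linarith) (by linarith) fun hjk =>
        hne (congrArg some (Subtype.ext hjk))

theorem nontrivial_option_Icc (hn : 2 ≤ n) : Nontrivial (Option (Set.Icc 1 (n - 1))) :=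
  have : Nonempty (Set.Icc 1 (n - 1)) := ⟨⟨1, le_rfl, by omega⟩⟩
  inferInstance

theorem card_option_Icc (hn : 1 ≤ n) : Nat.card (Option (Set.Icc 1 (n - 1))) = n := by
  rw [Finite.card_option, Nat.card_eq_fintype_card, Fintype.card_ofFinset, Nat.card_Icc,
    Nat.add_sub_cancel, Nat.sub_add_cancel hn]

theorem polyhedronFace_inequalitySlack_some (k : Set.Icc 1 (n - 1)) :
    polyhedronFace (inequalitySlack n) (some k) =
      {p ∈ polyhedron (inequalitySlack n) | p.2 = lowerLine n k p.1} := by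
  simp only [polyhedronFace, inequalitySlack_some_apply, sub_eq_zero]

theorem polyhedronFace_inequalitySlack_none :
    polyhedronFace (inequalitySlack n) none =
      {p ∈ polyhedron (inequalitySlack n) | p.2 = upperLine n p.1} := by
  simp only [polyhedronFace, inequalitySlack_none_apply, sub_eq_zero, eq_comm]

theorem setOf_forall_ne_some_inequalitySlack_nonneg (k : Set.Icc 1 (n - 1)) :
    {p | ∀ i ≠ some k, 0 ≤ inequalitySlack n i p} =
      {p | (∀ j ∈ Set.Icc 1 (n - 1), j ≠ k → p.2 ≥ lowerLine n j p.1) ∧ p.2 ≤ upperLine n p.1} := by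
  simp [Option.forall, inequalitySlack_some_apply, inequalitySlack_none_apply,
    Subtype.ext_iff, and_comm]

theorem setOf_forall_ne_none_inequalitySlack_nonneg :
    {p | ∀ i ≠ none, 0 ≤ inequalitySlack n i p} =
      {p | ∀ j ∈ Set.Icc 1 (n - 1), p.2 ≥ lowerLine n j p.1} := by
  simp [Option.forall, inequalitySlack_some_apply]

end Polygon

theorem theorem5p1 (n : ℕ) (hn : 5 ≤ n) :
    -- the inequalities describe the polytope
    polyG n = {p : ℝ × ℝ |
      (∀ k ∈ Set.Icc 1 (n - 1), p.2 ≥ lowerLine n k p.1) ∧ p.2 ≤ upperLine n p.1} ∧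
    -- no inequality of the system can be dropped
    (∀ j ∈ Set.Icc 1 (n - 1), polyG n ≠ {p : ℝ × ℝ |
      (∀ k ∈ Set.Icc 1 (n - 1), k ≠ j → p.2 ≥ lowerLine n k p.1) ∧ p.2 ≤ upperLine n p.1}) ∧
    (polyG n ≠ {p : ℝ × ℝ | ∀ k ∈ Set.Icc 1 (n - 1), p.2 ≥ lowerLine n k p.1}) ∧
    -- the facets are exactly the sets where one of the inequalities is an equality
    (∀ F : Set (ℝ × ℝ), IsFacet (polyG n) F ↔
      (∃ k ∈ Set.Icc 1 (n - 1), F = {p ∈ polyG n | p.2 = lowerLine n k p.1}) ∨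
      F = {p ∈ polyG n | p.2 = upperLine n p.1}) ∧
    -- there are exactly `n` of them
    {F : Set (ℝ × ℝ) | IsFacet (polyG n) F}.ncard = n := by
  have := nontrivial_option_Icc (n := n) (by omega)
  have irredundant := isIrredundant_inequalitySlack (n := n) (by omega)
  rw [polyG_eq_polyhedron hn]
  refine ⟨?_, fun j hj => ?_, ?_, fun F => ?_, ?_⟩
  · exact Set.ext fun _ => mem_polyhedron_inequalitySlack
  · rw [← setOf_forall_ne_some_inequalitySlack_nonneg ⟨j, hj⟩]
    exact irredundant.polyhedron_ne _
  · rw [← setOf_forall_ne_none_inequalitySlack_nonneg]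
    exact irredundant.polyhedron_ne _
  · rw [irredundant.isFacet_iff, Option.exists, or_comm, polyhedronFace_inequalitySlack_none]
    simp only [polyhedronFace_inequalitySlack_some, Subtype.exists, exists_prop]
  · rw [irredundant.ncard_setOf_isFacet, card_option_Icc (by omega)]
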